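/- Model. A deterministic distributed algorithm in the LOCAL model runs on a finite simple graph $G=(V,E)$ whose nodes are computers. The edges incident to a node of degree $\delta$ are labelled at that node with port numbers $1,\dots,\delta$, and the nodes carry distinct natural-number identifiers; the port numbering and the identifiers are chosen by an adversary. Initially a node knows only its degree and its identifier. All nodes run the same deterministic algorithm in synchronous rounds: in each round every node sends a message (of unbounded size) to each neighbour, receives a message from each neighbour, and updates its local state. A node may stop and announce a value for each of its incident edges. The algorithm runs in $T$ rounds if after at most $T$ rounds all nodes have stopped; the two endpoints of every edge must announce the same value for it. For $x\colon E\to[0,1]$ and $v\in V$ let $x[v]=\sum_{e\in E:\, v\in e}x(e)$. The function $x$ is a fractional matching if $x[v]\le 1$ for all $v\in V$, and it is a maximal fractional matching if moreover $x[u]=1$ or $x[v]=1$ for every edge $\{u,v\}\in E$. Theorem (Upper bound). Let $d\ge 0$ be any integer constant and let $\Delta=2d+1$. Then there is a deterministic distributed algorithm in the LOCAL model (depending only on $d$) that runs in $5\Delta^3$ rounds and that finds, in every graph of maximum degree at most $\Delta$, for every port numbering and every assignment of distinct identifiers, a maximal fractional matching $x$ whose values are all of the form $a/2^d$ with $a\in\{0,1,\dots,2^d\}$.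 -/

import Mathlib

/-!
Deterministic distributed algorithms in the LOCAL model, and maximal fractional matchings.
-/

universe u

/-- A port numbering of a graph: every node `v` of degree `δ` refers to its incident edges (equivalently, its
neighbours) by the port numbers `0, …, δ - 1`; `nbr v i` is the neighbour behind port `i` of `v`. -/
structure PortNumbering {V : Type*} (G : SimpleGraph V) [G.LocallyFinite] where
  nbr : ∀ v : V, Fin (G.degree v) ≃ G.neighborSet v

namespace PortNumbering

variable {V : Type*} {G : SimpleGraph V} [G.LocallyFinite] (P : PortNumbering G)

/-- The neighbour of `v` behind port `i`. -/
def neighbor (v : V) (i : Fin (G.degree v)) : V := (P.nbr v i : V)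

theorem adj_neighbor (v : V) (i : Fin (G.degree v)) : G.Adj v (P.neighbor v i) :=
  (P.nbr v i).2

/-- The edge behind port `i` of `v`. -/
def edge (v : V) (i : Fin (G.degree v)) : G.edgeSet :=
  ⟨s(v, P.neighbor v i), P.adj_neighbor v i⟩

/-- The port number, at the other endpoint, of the edge behind port `i` of `v`. -/
def backPort (v : V) (i : Fin (G.degree v)) : Fin (G.degree (P.neighbor v i)) :=
  (P.nbr (P.neighbor v i)).symm ⟨v, (P.adj_neighbor v i).symm⟩

end PortNumbering

/-- A deterministic synchronous message-passing algorithm in the LOCAL model, whose local outputs assign an element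
of `Y` to each incident edge. A node initially knows only its degree `δ` and its identifier. -/
structure LocalAlgorithm (Y : Type) where
  /-- the local states of a node of degree `δ` -/
  State : (δ : ℕ) → Type
  /-- the messages (of unbounded size) -/
  Msg : Type
  /-- the initial state, given the degree and the identifier -/
  init : (δ : ℕ) → (ident : ℕ) → State δ
  /-- the message sent through each port -/
  send : (δ : ℕ) → State δ → Fin δ → Msg
  /-- the new state, given the message received from each port -/
  receive : (δ : ℕ) → State δ → (Fin δ → Msg) → State δ
  /-- `some y` if the node has stopped and announced the value `y i` for the edge behind each port `i`;
  `none` if it has not stopped -/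
  output : (δ : ℕ) → State δ → Option (Fin δ → Y)
  /-- a node that has stopped does not change its state any more -/
  stopped : ∀ (δ : ℕ) (s : State δ) (m : Fin δ → Msg), (output δ s).isSome → receive δ s m = s

namespace LocalAlgorithm

variable {Y : Type} (A : LocalAlgorithm Y)
variable {V : Type*} (G : SimpleGraph V) [G.LocallyFinite] (P : PortNumbering G) (ident : V → ℕ)

/-- The local state of each node after `t` synchronous communication rounds. -/
def state : ℕ → (v : V) → A.State (G.degree v)
  | 0, v => A.init (G.degree v) (ident v)
  | t + 1, v =>
      A.receive (G.degree v) (state t v) fun i =>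
        A.send (G.degree (P.neighbor v i)) (state t (P.neighbor v i)) (P.backPort v i)

/-- Within `T` rounds all nodes have stopped, and their local outputs form the edge labelling `x`:
every node has announced the value `x e` for each of its incident edges `e`. -/
def ComputesWithin (T : ℕ) (x : G.edgeSet → Y) : Prop :=
  ∀ v : V, A.output (G.degree v) (A.state G P ident T v) = some fun i => x (P.edge v i)

end LocalAlgorithm

section FractionalMatching

variable {V : Type*} [DecidableEq V] (G : SimpleGraph V) [Fintype G.edgeSet]

/-- `x[v]`: the sum of the values of the edges incident to `v`. -/
def nodeSum (x : G.edgeSet → ℚ) (v : V) : ℚ :=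
  ∑ e ∈ Finset.univ.filter (fun e : G.edgeSet => v ∈ (e : Sym2 V)), x e

/-- `x : E → [0, 1]` with `x[v] ≤ 1` for every node `v`. -/
def IsFractionalMatching (x : G.edgeSet → ℚ) : Prop :=
  (∀ e, 0 ≤ x e ∧ x e ≤ 1) ∧ ∀ v, nodeSum G x v ≤ 1

/-- A fractional matching in which every edge has a saturated endpoint. -/
def IsMaximalFractionalMatching (x : G.edgeSet → ℚ) : Prop :=
  IsFractionalMatching G x ∧ ∀ u v, G.Adj u v → nodeSum G x u = 1 ∨ nodeSum G x v = 1

end FractionalMatching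

/-- The set `{a / 2 ^ d : a = 0, 1, …, 2 ^ d}`. -/
def dyadicFractions (d : ℕ) : Set ℚ :=
  {q | ∃ a : ℕ, a ≤ 2 ^ d ∧ q = (a : ℚ) / (2 : ℚ) ^ d}

/-!
Since identifiers are distinct, a network is a graph on `ℕ`, given by its neighbourhood function `N : ℕ → Finset ℕ`.
A rule whose value at a node is determined by the graph up to distance `T` is run in `T` rounds by gathering that part
of the graph (`gather_computesWithin`). It therefore suffices to define the edge values by a global procedure `finish`,
to show that they are a maximal fractional matching (`finish_spec`), and to bound the distance on which they depend
(`isLocal_finish`).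

The procedure maintains a residual graph all of whose nodes have the same remaining capacity `c`, while every edge
outside of it has a saturated endpoint (`IsResidual`). A phase halves `c` and decreases the maximum degree from
`2e + 3` to `2e + 1`, so after `d` phases `c = 2⁻ᵈ`, the residual graph has maximum degree `1`, and saturating its
edges finishes the job. A phase has two parts.

* The order of the identifiers yields `2e + 5` colour bits such that every node of the full odd degree `2e + 3` has a
  neighbour that differs in some bit (`exists_colour_ne`). For each bit, a maximal matching between the nodes with
  different values is found greedily in as many steps as the degree, and its edges get the whole capacity `c`. Each
  node of full degree is now matched or has a matched neighbour, so the degree drops to `2e + 2` (`card_sweep_le`).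
* A maximal matching in the bipartite double cover, each edge with weight `c / 2`, saturates the nodes that are matched
  twice. By maximality, an edge without a saturated endpoint joins two nodes that are matched once. The partner of such
  a node is matched twice, so the degree drops once more (`card_halvingStage_le`).

A step of the greedy matching takes three rounds, so a phase takes `O(e²)` rounds, within the difference
`5 (2e + 3)³ - 5 (2e + 1)³`.
-/

namespace DyadicMatching

/-! ### Locality -/

/-- The graphs with neighbourhood functions `N` and `N'` look the same from `v` up to distance `r`: the
neighbourhoods of all nodes at distance less than `r` from `v` coincide. -/
def Agree : ℕ → (ℕ → Finset ℕ) → (ℕ → Finset ℕ) → ℕ → Prop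
  | 0, _, _, _ => True
  | r + 1, N, N', v => N v = N' v ∧ ∀ u ∈ N v, Agree r N N' u

theorem Agree.of_succ {N N' : ℕ → Finset ℕ} :
    ∀ {r : ℕ} {v : ℕ}, Agree (r + 1) N N' v → Agree r N N' v
  | 0, _, _ => trivial
  | _ + 1, _, h => ⟨h.1, fun u hu => (h.2 u hu).of_succ⟩

theorem Agree.mono {N N' : ℕ → Finset ℕ} {r s v : ℕ} (hrs : r ≤ s) (h : Agree s N N' v) :
    Agree r N N' v := by
  induction s, hrs using Nat.le_induction with
  | base => exact h
  | succ s _ ih => exact ih h.of_succ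

/-- Partial knowledge of a graph `N` stays sufficient when it is enlarged. -/
theorem Agree.of_subset {N K K' : ℕ → Finset ℕ} (hKK' : ∀ w, K w ⊆ K' w) (hK' : ∀ w, K' w ⊆ N w) :
    ∀ {r : ℕ} {v : ℕ}, Agree r K N v → Agree r K' N v
  | 0, _, _ => trivial
  | _ + 1, v, h => by
    have hv : K' v = N v := (hK' v).antisymm (h.1 ▸ hKK' v)
    exact ⟨hv, fun u hu => (h.2 u (h.1 ▸ hv ▸ hu)).of_subset hKK' hK'⟩

/-- The node labelling `X N` of a graph `N` is determined at each node by what is seen up to distance `r`. -/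
def IsLocal {α : Type*} (r : ℕ) (X : (ℕ → Finset ℕ) → ℕ → α) : Prop :=
  ∀ N N' v, Agree r N N' v → X N v = X N' v

namespace IsLocal

variable {α β : Type*} {r s : ℕ} {X : (ℕ → Finset ℕ) → ℕ → α} {Y : (ℕ → Finset ℕ) → ℕ → β}

theorem mono (hX : IsLocal r X) (hrs : r ≤ s) : IsLocal s X :=
  fun N N' v h => hX N N' v (h.mono hrs)

theorem comp (hX : IsLocal r X) (f : ℕ → α → β) : IsLocal r fun N v => f v (X N v) :=
  fun N N' v h => congrArg (f v) (hX N N' v h)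

theorem prodMk (hX : IsLocal r X) (hY : IsLocal r Y) : IsLocal r fun N v => (X N v, Y N v) :=
  fun N N' v h => Prod.ext (hX N N' v h) (hY N N' v h)

/-- One more round of communication: a label that is computed from the labels `X` of a node and its neighbours. -/
theorem exchange (hX : IsLocal r X)
    (hY : ∀ N N' v, X N v = X N' v → (∀ u ∈ N v, X N u = X N' u) → Y N v = Y N' v) :
    IsLocal (r + 1) Y :=
  fun N N' v h => hY N N' v (hX N N' v h.of_succ) fun u hu => hX N N' u (h.2 u hu)

end IsLocal

/-! ### Running a local rule as a distributed algorithm -/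

/-- The local state of a node of degree `δ` that gathers the graph around it: the number of elapsed rounds, its own
identifier, the identifiers of its neighbours, and the neighbourhoods (in terms of identifiers) known so far. -/
structure Knowledge (δ : ℕ) where
  time : ℕ
  ident : ℕ
  port : Fin δ → ℕ
  nbhd : ℕ → Finset ℕ

/-- Gather the graph for `T` rounds, then apply the rule `F` to the part of the graph that has been seen; the value
for the edge towards the neighbour with identifier `m` is `F K n m`, where `n` is the identifier of the node. -/
abbrev gather {Y : Type} (T : ℕ) (F : (ℕ → Finset ℕ) → ℕ → ℕ → Y) : LocalAlgorithm Y where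
  State := Knowledge
  Msg := ℕ × (ℕ → Finset ℕ)
  init _ n := ⟨0, n, fun _ => 0, fun _ => ∅⟩
  send _ s _ := (s.ident, s.nbhd)
  receive _ s m :=
    if s.time = T then s
    else
      { time := s.time + 1
        ident := s.ident
        port := fun i => (m i).1
        nbhd := fun w =>
          if w = s.ident then Finset.univ.image fun i => (m i).1
          else Finset.univ.biUnion fun i => (m i).2 w }
  output _ s := if s.time = T then some fun i => F s.nbhd s.ident (s.port i) else none
  stopped _ s m h := by
    by_cases hs : s.time = T
    · simp [hs]
    · simp [hs] at h

section Transport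

variable {V : Type*} [Fintype V] (G : SimpleGraph V) [DecidableRel G.Adj] (ident : V → ℕ)

/-- The graph `G` with its nodes renamed to their identifiers, as a neighbourhood function; a number that is not an
identifier is an isolated node. -/
def identGraph (n : ℕ) : Finset ℕ :=
  (Finset.univ.filter fun v => ident v = n).biUnion fun v => (G.neighborFinset v).image ident

variable {G ident}

theorem mem_identGraph {n m : ℕ} :
    m ∈ identGraph G ident n ↔ ∃ v u, ident v = n ∧ ident u = m ∧ G.Adj v u := by
  simp only [identGraph, Finset.mem_biUnion, Finset.mem_filter, Finset.mem_univ, true_and,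
    Finset.mem_image, SimpleGraph.mem_neighborFinset]
  constructor
  · rintro ⟨v, hv, u, h, hu⟩
    exact ⟨v, u, hv, hu, h⟩
  · rintro ⟨v, u, hv, hu, h⟩
    exact ⟨v, hv, u, h, hu⟩

theorem identGraph_ident (hid : Function.Injective ident) (v : V) :
    identGraph G ident (ident v) = (G.neighborFinset v).image ident := by
  ext m
  simp only [mem_identGraph, Finset.mem_image, SimpleGraph.mem_neighborFinset]
  constructor
  · rintro ⟨v', u, hv, hu, h⟩
    exact ⟨u, hid hv ▸ h, hu⟩
  · rintro ⟨u, h, hu⟩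
    exact ⟨v, u, rfl, hu, h⟩

theorem image_port (hid : Function.Injective ident) (P : PortNumbering G) (v : V) :
    (Finset.univ.image fun i => ident (P.neighbor v i)) = identGraph G ident (ident v) := by
  rw [identGraph_ident hid]
  ext m
  simp only [Finset.mem_image, Finset.mem_univ, true_and, SimpleGraph.mem_neighborFinset]
  constructor
  · rintro ⟨i, rfl⟩
    exact ⟨_, P.adj_neighbor v i, rfl⟩
  · rintro ⟨u, hu, rfl⟩
    exact ⟨(P.nbr v).symm ⟨u, hu⟩, by simp [PortNumbering.neighbor]⟩

theorem gather_state {Y : Type} {T : ℕ} {F : (ℕ → Finset ℕ) → ℕ → ℕ → Y}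
    (hid : Function.Injective ident) (P : PortNumbering G) :
    ∀ t ≤ T, ∀ v : V,
      ((gather T F).state G P ident t v).time = t ∧
      ((gather T F).state G P ident t v).ident = ident v ∧
      (t ≠ 0 → ∀ i, ((gather T F).state G P ident t v).port i = ident (P.neighbor v i)) ∧
      (∀ w, ((gather T F).state G P ident t v).nbhd w ⊆ identGraph G ident w) ∧
      Agree t ((gather T F).state G P ident t v).nbhd (identGraph G ident) (ident v) := by
  intro t
  induction t with
  | zero =>
    intro _ v
    exact ⟨rfl, rfl, fun h => absurd rfl h, fun w => Finset.empty_subset _, trivial⟩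
  | succ t ih =>
    intro ht v
    have ih := ih (by omega)
    have ht' : ((gather T F).state G P ident t v).time ≠ T := by rw [(ih v).1]; omega
    have hstate : (gather T F).state G P ident (t + 1) v =
        { time := t + 1
          ident := ident v
          port := fun i => ident (P.neighbor v i)
          nbhd := fun w =>
            if w = ident v then identGraph G ident (ident v)
            else Finset.univ.biUnion fun i =>
              ((gather T F).state G P ident t (P.neighbor v i)).nbhd w } := by
      have hport : ∀ i, ((gather T F).state G P ident t (P.neighbor v i)).ident =
          ident (P.neighbor v i) := fun i => (ih _).2.1
      refine (if_neg ht').trans ?_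
      rw [(ih v).1, (ih v).2.1, ← image_port hid P v]
      simp only [hport]
    have hsub : ∀ w, ((gather T F).state G P ident (t + 1) v).nbhd w ⊆ identGraph G ident w := by
      intro w
      rw [hstate]
      dsimp only
      split_ifs with hw
      · rw [hw]
      · exact Finset.biUnion_subset.2 fun i _ => (ih _).2.2.2.1 w
    refine ⟨by rw [hstate], by rw [hstate], fun _ i => by rw [hstate], hsub, ?_⟩
    have hv : ((gather T F).state G P ident (t + 1) v).nbhd (ident v) =
        identGraph G ident (ident v) := by
      rw [hstate]
      simp
    refine ⟨hv, fun u hu => ?_⟩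
    rw [hv, ← image_port hid P v] at hu
    obtain ⟨i, -, rfl⟩ := Finset.mem_image.1 hu
    refine (ih (P.neighbor v i)).2.2.2.2.of_subset (fun w => ?_) hsub
    rw [hstate]
    dsimp only
    split_ifs with hw
    · rw [hw]
      exact (ih _).2.2.2.1 _
    · exact Finset.subset_biUnion_of_mem
        (fun i => ((gather T F).state G P ident t (P.neighbor v i)).nbhd w) (Finset.mem_univ i)

theorem gather_computesWithin {Y : Type} {T : ℕ} (hT : T ≠ 0) {F : (ℕ → Finset ℕ) → ℕ → ℕ → Y}
    (hF : IsLocal T F) (hid : Function.Injective ident) (P : PortNumbering G) {x : G.edgeSet → Y}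
    (hx : ∀ v u (h : G.Adj v u), x ⟨s(v, u), h⟩ = F (identGraph G ident) (ident v) (ident u)) :
    (gather T F).ComputesWithin G P ident T x := by
  intro v
  obtain ⟨h1, h2, h3, -, h5⟩ := gather_state (F := F) hid P T le_rfl v
  change ite _ _ _ = _
  rw [if_pos h1]
  congr 1
  funext i
  rw [h3 hT, h2, hF _ _ _ h5]
  exact (hx _ _ (P.adj_neighbor v i)).symm

end Transport

/-! ### Greedy maximal matchings in bipartite graphs -/

section Greedy

/-- The proposal of `w` in a bipartite graph in which each proposer `w` is adjacent to the acceptors in `E w`. The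
first and second component of `s v` are the partners of `v` as a proposer and as an acceptor (`⊤` for none). A free
proposer proposes to its smallest free neighbour. -/
def proposal (E : ℕ → Finset ℕ) (s : ℕ → WithTop ℕ × WithTop ℕ) (w : ℕ) : WithTop ℕ :=
  if (s w).1 = ⊤ then ((E w).filter fun b => (s b).2 = ⊤).min else ⊤

/-- An acceptor `b`, all of whose proposers are in `U b`, accepts the smallest one. -/
def answer (U : ℕ → Finset ℕ) (prop : ℕ → WithTop ℕ) (b : ℕ) : WithTop ℕ :=
  ((U b).filter fun w => prop w = WithTop.some b).min

/-- The partners after the answers `ans` have been announced. -/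
def accept (U : ℕ → Finset ℕ) (s : ℕ → WithTop ℕ × WithTop ℕ) (ans : ℕ → WithTop ℕ) (v : ℕ) :
    WithTop ℕ × WithTop ℕ :=
  (if (s v).1 = ⊤ then ((U v).filter fun b => ans b = WithTop.some v).min else (s v).1,
    if (s v).2 = ⊤ then ans v else (s v).2)

/-- `k` repetitions of proposing and accepting. -/
def greedyMatching (U E : ℕ → Finset ℕ) : ℕ → ℕ → WithTop ℕ × WithTop ℕ
  | 0 => fun _ => (⊤, ⊤)
  | k + 1 => accept U (greedyMatching U E k) (answer U (proposal E (greedyMatching U E k)))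

/-- `s` encodes a matching between proposers and acceptors in the bipartite graph `E`. -/
structure IsPartial (E : ℕ → Finset ℕ) (s : ℕ → WithTop ℕ × WithTop ℕ) : Prop where
  iff : ∀ w b : ℕ, (s w).1 = WithTop.some b ↔ (s b).2 = WithTop.some w
  mem : ∀ w b : ℕ, (s w).1 = WithTop.some b → b ∈ E w

variable {U E : ℕ → Finset ℕ} {s : ℕ → WithTop ℕ × WithTop ℕ}

theorem mem_of_proposal {w b : ℕ} (h : proposal E s w = WithTop.some b) :
    (s w).1 = ⊤ ∧ b ∈ E w ∧ (s b).2 = ⊤ := by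
  unfold proposal at h
  split_ifs at h with hw
  · have := Finset.mem_of_min h
    rw [Finset.mem_filter] at this
    exact ⟨hw, this⟩
  · exact absurd h (WithTop.top_ne_coe)

theorem proposal_of_answer {prop : ℕ → WithTop ℕ} {w b : ℕ} (h : answer U prop b = WithTop.some w) :
    w ∈ U b ∧ prop w = WithTop.some b := by
  have := Finset.mem_of_min h
  rwa [Finset.mem_filter] at this

theorem accept_fst_iff (hU : ∀ w b, b ∈ E w → b ∈ U w ∧ w ∈ U b) (w b : ℕ) :
    (accept U s (answer U (proposal E s)) w).1 = WithTop.some b ↔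
      (s w).1 = WithTop.some b ∨ answer U (proposal E s) b = WithTop.some w := by
  by_cases hw : (s w).1 = ⊤
  · simp only [accept, hw, if_true, WithTop.top_ne_coe, false_or]
    refine ⟨fun h => (Finset.mem_filter.1 (Finset.mem_of_min h)).2, fun h => ?_⟩
    have hb := proposal_of_answer h
    have hmem : b ∈ (U w).filter fun b => answer U (proposal E s) b = WithTop.some w :=
      Finset.mem_filter.2 ⟨(hU w b (mem_of_proposal hb.2).2.1).1, h⟩
    obtain ⟨b', hb'⟩ := Finset.min_of_mem hmem
    -- a proposer makes a single proposal, so at most one acceptor answers it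
    have := (proposal_of_answer (Finset.mem_filter.1 (Finset.mem_of_min hb')).2).2
    rw [hb', ← hb.2, this]
  · simp only [accept, hw, if_false]
    refine ⟨Or.inl, fun h => h.resolve_right fun h => ?_⟩
    exact hw (mem_of_proposal (proposal_of_answer h).2).1

theorem accept_snd_iff (w b : ℕ) :
    (accept U s (answer U (proposal E s)) b).2 = WithTop.some w ↔
      (s b).2 = WithTop.some w ∨ answer U (proposal E s) b = WithTop.some w := by
  by_cases hb : (s b).2 = ⊤
  · simp [accept, hb]
  · simp only [accept, hb, if_false]
    refine ⟨Or.inl, fun h => h.resolve_right fun h => ?_⟩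
    exact hb (mem_of_proposal (proposal_of_answer h).2).2.2

theorem isPartial_greedyMatching (hU : ∀ w b, b ∈ E w → b ∈ U w ∧ w ∈ U b) :
    ∀ k, IsPartial E (greedyMatching U E k)
  | 0 => ⟨by simp [greedyMatching], by simp [greedyMatching]⟩
  | k + 1 => by
    have ih := isPartial_greedyMatching hU k
    refine ⟨fun w b => ?_, fun w b h => ?_⟩
    · rw [greedyMatching, accept_fst_iff hU, accept_snd_iff, ih.iff]
    · rw [greedyMatching, accept_fst_iff hU] at h
      exact h.elim (ih.mem w b) fun h => (mem_of_proposal (proposal_of_answer h).2).2.1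

/-- Each repetition matches a free proposer or the acceptor it proposes to, so the number of free neighbours of a
free proposer decreases. -/
theorem greedyMatching_progress (hU : ∀ w b, b ∈ E w → b ∈ U w ∧ w ∈ U b) (w : ℕ) :
    ∀ k, (greedyMatching U E k w).1 = ⊤ →
      ((E w).filter fun b => (greedyMatching U E k b).2 = ⊤) = ∅ ∨
      ((E w).filter fun b => (greedyMatching U E k b).2 = ⊤).card + k ≤ (E w).card
  | 0, _ => Or.inr (Finset.card_filter_le _ _)
  | k + 1, h => by
    set s := greedyMatching U E k with hs
    have hstep : greedyMatching U E (k + 1) = accept U s (answer U (proposal E s)) := rfl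
    have hsnd : ∀ b, (greedyMatching U E (k + 1) b).2 = ⊤ →
        (s b).2 = ⊤ ∧ answer U (proposal E s) b = ⊤ := by
      intro b hb
      rw [hstep] at hb
      by_cases hb' : (s b).2 = ⊤
      · simpa [accept, hb'] using hb
      · simp [accept, hb'] at hb
    have hfst : (s w).1 = ⊤ := by
      by_contra hw
      rw [hstep] at h
      simp [accept, hw] at h
    have hsub : ((E w).filter fun b => (greedyMatching U E (k + 1) b).2 = ⊤) ⊆
        (E w).filter fun b => (s b).2 = ⊤ :=
      Finset.monotone_filter_right _ fun b _ hb => (hsnd b hb).1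
    rcases Finset.eq_empty_or_nonempty ((E w).filter fun b => (s b).2 = ⊤) with he | hne
    · exact Or.inl (Finset.subset_empty.1 (he ▸ hsub))
    · have ih := (greedyMatching_progress hU w k hfst).resolve_left hne.ne_empty
      obtain ⟨b, hb⟩ := Finset.min_of_nonempty hne
      have hprop : proposal E s w = WithTop.some b := by rw [proposal, if_pos hfst, hb]
      have hbE := Finset.mem_of_min hb
      have hlt := Finset.card_lt_card (Finset.ssubset_iff_of_subset hsub |>.2 ⟨b, hbE, fun hb' => by
        have := Finset.min_eq_top.1 (hsnd b (Finset.mem_filter.1 hb').2).2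
        exact Finset.notMem_empty w (this ▸ Finset.mem_filter.2
          ⟨(hU w b (Finset.mem_filter.1 hbE).1).2, hprop⟩)⟩)
      exact Or.inr (by rw [← hs] at ih; omega)

theorem greedyMatching_maximal (hU : ∀ w b, b ∈ E w → b ∈ U w ∧ w ∈ U b) {k w b : ℕ}
    (hk : (E w).card ≤ k) (hb : b ∈ E w) :
    (greedyMatching U E k w).1 ≠ ⊤ ∨ (greedyMatching U E k b).2 ≠ ⊤ := by
  by_contra! h
  have hmem : b ∈ (E w).filter fun b => (greedyMatching U E k b).2 = ⊤ :=
    Finset.mem_filter.2 ⟨hb, h.2⟩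
  have hpos := Finset.card_pos.2 ⟨b, hmem⟩
  rcases greedyMatching_progress hU w k h.1 with he | he
  · exact Finset.notMem_empty b (he ▸ hmem)
  · omega

theorem isLocal_greedyMatching {r : ℕ} {U E : (ℕ → Finset ℕ) → ℕ → Finset ℕ} (hU : IsLocal r U)
    (hE : IsLocal r E) (hUN : ∀ N v, U N v ⊆ N v) (hEU : ∀ N v, E N v ⊆ U N v) :
    ∀ k, IsLocal (r + 3 * k) fun N => greedyMatching (U N) (E N) k
  | 0 => fun _ _ _ _ => rfl
  | k + 1 => by
    have ih := isLocal_greedyMatching hU hE hUN hEU k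
    have hUE := (hU.prodMk hE).mono (show r ≤ r + 3 * k by omega)
    have hprop : IsLocal (r + 3 * k + 1) fun N => proposal (E N) (greedyMatching (U N) (E N) k) := by
      refine (hUE.prodMk ih).exchange fun N N' v hv hu => ?_
      simp only [Prod.mk.injEq] at hv hu
      unfold proposal
      rw [hv.2, ← hv.1.2]
      congr 2
      refine Finset.filter_congr fun b hb => ?_
      rw [(hu b (hUN N v (hEU N v hb))).2]
    have hans : IsLocal (r + 3 * k + 2) fun N =>
        answer (U N) (proposal (E N) (greedyMatching (U N) (E N) k)) := by
      refine ((hUE.mono (by omega)).prodMk hprop).exchange fun N N' v hv hu => ?_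
      simp only [Prod.mk.injEq] at hv hu
      unfold answer
      rw [← hv.1.1]
      congr 1
      refine Finset.filter_congr fun w hw => ?_
      rw [(hu w (hUN N v hw)).2]
    refine (((hUE.prodMk ih).mono (show _ ≤ r + 3 * k + 2 by omega)).prodMk hans).exchange
      fun N N' v hv hu => ?_
    simp only [Prod.mk.injEq] at hv hu
    simp only [greedyMatching]
    unfold accept
    rw [hv.1.2, ← hv.1.1.1, hv.2]
    congr 3
    refine Finset.filter_congr fun b hb => ?_
    rw [(hu b (hUN N v hb)).2]

end Greedy

/-! ### Weak colouring of nodes of odd degree -/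

section Colouring

variable {H : ℕ → Finset ℕ}

/-- The rank of `u` among the neighbours of `w`. -/
def rank (H : ℕ → Finset ℕ) (w u : ℕ) : ℕ :=
  ((H w).filter fun z => z < u).card

/-- The smallest neighbour of `u` among those whose neighbour of rank `j` is `u`. -/
def leader (H : ℕ → Finset ℕ) (u j : ℕ) : WithTop ℕ :=
  ((H u).filter fun w => rank H w u = j).min

/-- The `2e + 3` colour bits of a node `w`. Bit `j ≤ 2e` says that `w` is the leader of its neighbour of rank `j`,
bit `2e + 1` that `w` has the full degree `2e + 1`, and bit `2e + 2` that more than `e` of its neighbours are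
smaller than `w`. -/
def colour (e : ℕ) (H : ℕ → Finset ℕ) (w j : ℕ) : Bool :=
  if j = 2 * e + 1 then decide ((H w).card = 2 * e + 1)
  else if j = 2 * e + 2 then decide (e < rank H w w)
  else decide (∃ u ∈ H w, leader H u j = WithTop.some w)

theorem rank_lt_rank {w u u' : ℕ} (hu : u ∈ H w) (h : u < u') : rank H w u < rank H w u' := by
  refine Finset.card_lt_card (Finset.ssubset_iff_of_subset ?_ |>.2
    ⟨u, Finset.mem_filter.2 ⟨hu, h⟩, fun h' => lt_irrefl u (Finset.mem_filter.1 h').2⟩)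
  exact Finset.monotone_filter_right _ fun z _ hz => lt_trans hz h

theorem rank_injOn {w u u' : ℕ} (hu : u ∈ H w) (hu' : u' ∈ H w) (h : rank H w u = rank H w u') :
    u = u' := by
  rcases lt_trichotomy u u' with hlt | heq | hlt
  · exact absurd h (rank_lt_rank hu hlt).ne
  · exact heq
  · exact absurd h (rank_lt_rank hu' hlt).ne'

theorem rank_mono (w : ℕ) : Monotone (rank H w) := fun _ _ h =>
  Finset.card_le_card (Finset.monotone_filter_right _ fun _ _ hz => lt_of_lt_of_le hz h)

theorem rank_lt_card {w u : ℕ} (hu : u ∈ H w) : rank H w u < (H w).card :=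
  Finset.card_lt_card (Finset.filter_ssubset.2 ⟨u, hu, lt_irrefl u⟩)

/-- If two neighbours of `v` both have `v` as their neighbour of rank `j`, then `v` has neighbours that differ in
bit `j`, namely the leader of `v` and any other such neighbour. -/
theorem exists_colour_ne_of_rank_eq (hs : ∀ v u, u ∈ H v → v ∈ H u) {e j v w w' : ℕ}
    (hj : j < 2 * e + 1) (hw : w ∈ H v) (hw' : w' ∈ H v) (hne : w ≠ w')
    (hrank : rank H w v = j) (hrank' : rank H w' v = j) :
    ∃ u ∈ H v, colour e H v j ≠ colour e H u j := by
  obtain ⟨m, hm⟩ := Finset.min_of_mem (s := (H v).filter fun w => rank H w v = j)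
    (Finset.mem_filter.2 ⟨hw, hrank⟩)
  have hmv := Finset.mem_filter.1 (Finset.mem_of_min hm)
  have hcol : ∀ u, colour e H u j = decide (∃ z ∈ H u, leader H z j = WithTop.some u) := fun u => by
    rw [colour, if_neg (by omega), if_neg (by omega)]
  have hlead : colour e H m j = true := by
    rw [hcol]
    exact decide_eq_true ⟨v, hs _ _ hmv.1, hm⟩
  have hother : ∀ u ∈ H v, rank H u v = j → u ≠ m → colour e H u j = false := by
    intro u hu hr hum
    rw [hcol]
    refine decide_eq_false ?_
    rintro ⟨z, hz, hzu⟩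
    have hzr := (Finset.mem_filter.1 (Finset.mem_of_min hzu)).2
    have hzv : z = v := rank_injOn hz (hs _ _ hu) (hzr.trans hr.symm)
    rw [hzv] at hzu
    exact hum (WithTop.coe_injective (hzu.symm.trans hm))
  obtain ⟨u, hu, hr, hum⟩ : ∃ u ∈ H v, rank H u v = j ∧ u ≠ m := by
    by_cases h : w = m
    · exact ⟨w', hw', hrank', fun h' => hne (h.trans h'.symm)⟩
    · exact ⟨w, hw, hrank, h⟩
  by_cases hv : colour e H v j = true
  · exact ⟨u, hu, by rw [hv, hother u hu hr hum]; decide⟩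
  · exact ⟨m, hmv.1, by rw [hlead]; exact hv⟩

/-- A node of full odd degree has a neighbour of a different colour. If all neighbours had the same degree and the
same majority orientation, say more smaller than larger neighbours, then the at least `e + 1` smaller neighbours `w`
of `v` would all satisfy `e < rank H w v ≤ 2e`, so that two of these ranks would coincide. -/
theorem exists_colour_ne (hs : ∀ v u, u ∈ H v → v ∈ H u) (hi : ∀ v, v ∉ H v) {e v : ℕ}
    (hv : (H v).card = 2 * e + 1) :
    ∃ u ∈ H v, ∃ j < 2 * e + 3, colour e H v j ≠ colour e H u j := by
  by_contra! h
  have hdeg : ∀ u ∈ H v, (H u).card = 2 * e + 1 := by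
    intro u hu
    have := h u hu (2 * e + 1) (by omega)
    simpa [colour, hv] using this
  have hmaj : ∀ u ∈ H v, (e < rank H v v ↔ e < rank H u u) := by
    intro u hu
    have := h u hu (2 * e + 2) (by omega)
    simpa [colour] using this
  have key : ∀ W ⊆ H v, ∀ R : Finset ℕ, R.card < W.card → (∀ w ∈ W, rank H w v ∈ R) →
      (∀ j ∈ R, j < 2 * e + 1) → False := by
    intro W hW R hR hmaps hlt
    obtain ⟨w, hw, w', hw', hne, heq⟩ := Finset.exists_ne_map_eq_of_card_lt_of_maps_to hR hmaps
    obtain ⟨u, hu, hu'⟩ := exists_colour_ne_of_rank_eq hs (hlt _ (hmaps w hw)) (hW hw) (hW hw')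
      hne rfl heq.symm
    exact hu' (h u hu _ (by have := hlt _ (hmaps w hw); omega))
  by_cases hmv : e < rank H v v
  · refine key ((H v).filter fun w => w < v) (Finset.filter_subset _ _) (Finset.Ico (e + 1) (2 * e + 1))
      ?_ (fun w hw => ?_) fun j hj => (Finset.mem_Ico.1 hj).2
    · rw [Nat.card_Ico]
      have : rank H v v = ((H v).filter fun w => w < v).card := rfl
      omega
    · obtain ⟨hw, hlt⟩ := Finset.mem_filter.1 hw
      have h1 := (hmaj w hw).1 hmv
      have h2 := rank_mono (H := H) w hlt.le
      have h3 := rank_lt_card (hs _ _ hw)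
      rw [hdeg w hw] at h3
      exact Finset.mem_Ico.2 ⟨by omega, h3⟩
  · refine key ((H v).filter fun w => ¬ w < v) (Finset.filter_subset _ _) (Finset.range e)
      ?_ (fun w hw => ?_) fun j hj => by have := Finset.mem_range.1 hj; omega
    · rw [Finset.card_range]
      have h1 : rank H v v = ((H v).filter fun w => w < v).card := rfl
      have h2 := Finset.card_filter_add_card_filter_not (s := H v) fun w => w < v
      omega
    · obtain ⟨hw, hge⟩ := Finset.mem_filter.1 hw
      have hlt : v < w := lt_of_le_of_ne (not_lt.1 hge) fun hvw => hi v (hvw ▸ hw)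
      have h1 := (hmaj w hw).not.1 hmv
      have h2 := rank_lt_rank (hs _ _ hw) hlt
      exact Finset.mem_range.2 (by omega)

theorem isLocal_colour {r : ℕ} {H : (ℕ → Finset ℕ) → ℕ → Finset ℕ} (hH : IsLocal r H)
    (hHN : ∀ N v, H N v ⊆ N v) (e : ℕ) : IsLocal (r + 2) fun N => colour e (H N) := by
  have hrank : IsLocal r fun N => rank (H N) :=
    hH.comp fun _ S u => (S.filter fun z => z < u).card
  have hlead : IsLocal (r + 1) fun N => leader (H N) := by
    refine (hH.prodMk hrank).exchange fun N N' v hv hu => ?_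
    simp only [Prod.mk.injEq] at hv hu
    funext j
    unfold leader
    rw [← hv.1]
    congr 1
    refine Finset.filter_congr fun w hw => ?_
    rw [(hu w (hHN N v hw)).2]
  refine (((hH.prodMk hrank).mono r.le_succ).prodMk hlead).exchange fun N N' v hv hu => ?_
  simp only [Prod.mk.injEq] at hv hu
  funext j
  unfold colour
  rw [← hv.1.1, hv.1.2]
  congr 2
  refine decide_eq_decide.2 (exists_congr fun u => and_congr_right fun h => ?_)
  rw [(hu u (hHN N v h)).2]

end Colouring

/-! ### Residual graphs -/

section Residual

/-- How often a node with partners `p` (as a proposer and as an acceptor) is matched. -/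
def timesMatched (p : WithTop ℕ × WithTop ℕ) : ℚ :=
  (if p.1 = ⊤ then 0 else 1) + if p.2 = ⊤ then 0 else 1

/-- A residual state `S` assigns to each node `v` its neighbours `(S v).1` in the residual graph and the values
`(S v).2 u` of the edges `{v, u}`. In `advance keep c s S`, the value of each edge has grown by `c` for each time it
occurs in the matching `s`, and the residual graph is restricted to the nodes whose partners satisfy `keep`. -/
def advance (keep : WithTop ℕ × WithTop ℕ → Bool) (c : ℚ) (s : ℕ → WithTop ℕ × WithTop ℕ)
    (S : ℕ → Finset ℕ × (ℕ → ℚ)) (v : ℕ) : Finset ℕ × (ℕ → ℚ) :=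
  (if keep (s v) then (S v).1.filter fun u => keep (s u) else ∅,
    fun u => (S v).2 u + c * ((if (s v).1 = WithTop.some u then 1 else 0) +
      if (s v).2 = WithTop.some u then 1 else 0))

/-- The invariant of the algorithm on the graph `N`: the residual graph is a subgraph of `N`, all its edges join nodes
with residual capacity `c`, and every other edge has a saturated endpoint. -/
structure IsResidual (d : ℕ) (N : ℕ → Finset ℕ) (c : ℚ) (S : ℕ → Finset ℕ × (ℕ → ℚ)) : Prop where
  subset : ∀ v, (S v).1 ⊆ N v
  symm : ∀ v u, u ∈ (S v).1 → v ∈ (S u).1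
  value_symm : ∀ v u, (S v).2 u = (S u).2 v
  dyadic : ∀ v u, ∃ m : ℕ, (S v).2 u = m / 2 ^ d
  load_le : ∀ v, ∑ u ∈ N v, (S v).2 u ≤ 1
  load_eq : ∀ v, (S v).1.Nonempty → ∑ u ∈ N v, (S v).2 u = 1 - c
  cover : ∀ v, ∀ u ∈ N v, u ∈ (S v).1 ∨
    ∑ z ∈ N v, (S v).2 z = 1 ∨ ∑ z ∈ N u, (S u).2 z = 1

variable {d : ℕ} {N : ℕ → Finset ℕ} {c c₁ c' : ℚ} {S : ℕ → Finset ℕ × (ℕ → ℚ)}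
  {keep : WithTop ℕ × WithTop ℕ → Bool} {s : ℕ → WithTop ℕ × WithTop ℕ} {E : ℕ → Finset ℕ}

theorem IsPartial.mem_of_snd (hs : IsPartial E s) {w b : ℕ} (h : (s b).2 = WithTop.some w) :
    b ∈ E w :=
  hs.mem w b ((hs.iff w b).2 h)

theorem sum_ite_eq_coe {A : Finset ℕ} {p : WithTop ℕ} (hp : ∀ u : ℕ, p = WithTop.some u → u ∈ A) :
    ∑ u ∈ A, (if p = WithTop.some u then (1 : ℚ) else 0) = if p = ⊤ then 0 else 1 := by
  induction p using WithTop.recTopCoe with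
  | top => simp
  | coe a =>
    rw [if_neg WithTop.coe_ne_top, Finset.sum_eq_single_of_mem a (hp a rfl), if_pos rfl]
    intro b _ hb
    exact if_neg fun h => hb (WithTop.coe_injective h).symm

theorem timesMatched_eq_zero (h : IsResidual d N c S) (hs : IsPartial E s)
    (hE : ∀ v, E v ⊆ (S v).1) {v : ℕ} (hv : ¬ (S v).1.Nonempty) : timesMatched (s v) = 0 := by
  have h1 : (s v).1 = ⊤ := by
    by_contra hne
    obtain ⟨b, hb⟩ := WithTop.ne_top_iff_exists.1 hne
    exact hv ⟨b, hE v (hs.mem v b hb.symm)⟩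
  have h2 : (s v).2 = ⊤ := by
    by_contra hne
    obtain ⟨w, hw⟩ := WithTop.ne_top_iff_exists.1 hne
    exact hv ⟨w, h.symm _ _ (hE w (hs.mem_of_snd hw.symm))⟩
  simp [timesMatched, h1, h2]

theorem load_advance (h : IsResidual d N c S) (hs : IsPartial E s)
    (hE : ∀ v, E v ⊆ (S v).1) (v : ℕ) :
    ∑ u ∈ N v, (advance keep c₁ s S v).2 u =
      ∑ u ∈ N v, (S v).2 u + c₁ * timesMatched (s v) := by
  simp only [advance, timesMatched]
  rw [Finset.sum_add_distrib, ← Finset.mul_sum, Finset.sum_add_distrib,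
    sum_ite_eq_coe fun u hu => h.subset v (hE v (hs.mem v u hu)),
    sum_ite_eq_coe fun u hu => h.subset v (h.symm _ _ (hE u (hs.mem_of_snd hu)))]

/-- The invariant is kept if no node exceeds its capacity, the kept nodes have capacity `c'` left, and every removed
edge has an endpoint whose capacity is used up. -/
theorem IsResidual.advance (h : IsResidual d N c S) (hs : IsPartial E s) (hE : ∀ v, E v ⊆ (S v).1)
    (hc₁ : ∃ m : ℕ, c₁ = m / 2 ^ d)
    (hle : ∀ v, c₁ * timesMatched (s v) ≤ c)
    (hkeep : ∀ v, keep (s v) = true → c₁ * timesMatched (s v) + c' = c)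
    (hdrop : ∀ v, ∀ u ∈ (S v).1, ¬ (keep (s v) = true ∧ keep (s u) = true) →
      c₁ * timesMatched (s v) = c ∨ c₁ * timesMatched (s u) = c) :
    IsResidual d N c' (advance keep c₁ s S) := by
  have hmem : ∀ v u, u ∈ (DyadicMatching.advance keep c₁ s S v).1 ↔
      u ∈ (S v).1 ∧ keep (s v) = true ∧ keep (s u) = true := by
    intro v u
    simp only [DyadicMatching.advance]
    split_ifs with hv
    · simp [hv]
    · simp [hv]
  refine ⟨fun v u hu => h.subset v ((hmem v u).1 hu).1, fun v u hu => ?_, fun v u => ?_,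
    fun v u => ?_, fun v => ?_, fun v hv => ?_, fun v u hu => ?_⟩
  · have := (hmem v u).1 hu
    exact (hmem u v).2 ⟨h.symm _ _ this.1, this.2.2, this.2.1⟩
  · simp only [DyadicMatching.advance, h.value_symm v u, hs.iff v u, ← hs.iff u v]
    rw [add_comm (ite _ _ _)]
  · obtain ⟨m, hm⟩ := h.dyadic v u
    obtain ⟨m₁, hm₁⟩ := hc₁
    refine ⟨m + m₁ * ((if (s v).1 = WithTop.some u then 1 else 0) +
      if (s v).2 = WithTop.some u then 1 else 0), ?_⟩
    simp only [DyadicMatching.advance, hm, hm₁]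
    push_cast
    ring
  · rw [load_advance h hs hE]
    by_cases hv : (S v).1.Nonempty
    · have := h.load_eq v hv
      have := hle v
      linarith
    · rw [timesMatched_eq_zero h hs hE hv, mul_zero, add_zero]
      exact h.load_le v
  · obtain ⟨u, hu⟩ := hv
    have hu := (hmem v u).1 hu
    have := h.load_eq v ⟨u, hu.1⟩
    have := hkeep v hu.2.1
    rw [load_advance h hs hE]
    linarith
  · have hsat : ∀ w, ∑ z ∈ N w, (S w).2 z = 1 →
        ∑ z ∈ N w, (DyadicMatching.advance keep c₁ s S w).2 z = 1 := by
      intro w hw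
      rw [load_advance h hs hE, hw]
      by_cases hne : (S w).1.Nonempty
      · -- an already saturated node with residual edges has `c = 0`
        have h1 := h.load_eq w hne
        obtain ⟨m₁, hm₁⟩ := hc₁
        have h2 : 0 ≤ c₁ * timesMatched (s w) := by
          refine mul_nonneg (hm₁ ▸ by positivity) ?_
          unfold timesMatched
          split_ifs <;> norm_num
        have := hle w
        linarith
      · rw [timesMatched_eq_zero h hs hE hne]
        ring
    by_cases hu' : u ∈ (S v).1
    · by_cases hk : keep (s v) = true ∧ keep (s u) = true
      · exact Or.inl ((hmem v u).2 ⟨hu', hk⟩)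
      · have h1 := h.load_eq v ⟨u, hu'⟩
        have h2 := h.load_eq u ⟨v, h.symm _ _ hu'⟩
        rw [load_advance h hs hE, load_advance h hs hE]
        exact Or.inr ((hdrop v u hu' hk).imp (fun h => by linarith) fun h => by linarith)
    · exact Or.inr (((h.cover v u hu).resolve_left hu').imp (hsat v) (hsat u))

theorem advance_fst_subset (v : ℕ) : (advance keep c s S v).1 ⊆ (S v).1 := by
  simp only [advance]
  split_ifs
  · exact Finset.filter_subset _ _
  · exact Finset.empty_subset _

theorem isLocal_advance {r : ℕ} {S : (ℕ → Finset ℕ) → ℕ → Finset ℕ × (ℕ → ℚ)}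
    {s : (ℕ → Finset ℕ) → ℕ → WithTop ℕ × WithTop ℕ} (hS : IsLocal r S) (hs : IsLocal r s)
    (hSN : ∀ N v, (S N v).1 ⊆ N v) (keep : WithTop ℕ × WithTop ℕ → Bool) (c : ℚ) :
    IsLocal (r + 1) fun N => advance keep c (s N) (S N) := by
  refine (hS.prodMk hs).exchange fun N N' v hv hu => ?_
  simp only [Prod.mk.injEq] at hv hu
  unfold advance
  rw [← hv.1, ← hv.2]
  congr 2
  refine Finset.filter_congr fun u h => ?_
  rw [(hu u (hSN N v h)).2]

end Residual

/-! ### The phases of the algorithm -/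

section Phases

/-- A maximal matching, computed in `k` steps, among the residual edges from nodes with `q` to nodes without `q`. The
edges of the matching get the whole capacity `c` of their endpoints. -/
def bichromaticStage (k : ℕ) (c : ℚ) (q : ℕ → Bool) (S : ℕ → Finset ℕ × (ℕ → ℚ)) :
    ℕ → Finset ℕ × (ℕ → ℚ) :=
  advance (fun p => p = (⊤, ⊤)) c
    (greedyMatching (fun v => (S v).1)
      (fun v => (S v).1.filter fun u => q v = true ∧ q u = false) k) S

/-- Bichromatic maximal matchings for the first `j` bits of the colouring `col`. -/
def sweep (k : ℕ) (c : ℚ) (col : ℕ → ℕ → Bool) (S : ℕ → Finset ℕ × (ℕ → ℚ)) :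
    ℕ → ℕ → Finset ℕ × (ℕ → ℚ)
  | 0 => S
  | j + 1 => bichromaticStage k c (fun v => col v j) (sweep k c col S j)

/-- A maximal matching in the bipartite double cover of the residual graph, in which every node occurs both as a
proposer and as an acceptor. The matching has weight `c / 2`, and the nodes matched exactly once remain. -/
def halvingStage (k : ℕ) (c : ℚ) (S : ℕ → Finset ℕ × (ℕ → ℚ)) : ℕ → Finset ℕ × (ℕ → ℚ) :=
  advance (fun p => timesMatched p = 1) (c / 2)
    (greedyMatching (fun v => (S v).1) (fun v => (S v).1) k) S

/-- The phase that reduces the maximum degree of the residual graph from `2e + 3` to `2e + 1` and its capacity from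
`c` to `c / 2`. -/
def phase (e : ℕ) (c : ℚ) (S : ℕ → Finset ℕ × (ℕ → ℚ)) : ℕ → Finset ℕ × (ℕ → ℚ) :=
  halvingStage (2 * e + 2) c
    (sweep (2 * e + 3) c (colour (e + 1) fun v => (S v).1) S (2 * e + 5))

/-- The edge values computed from a residual graph of maximum degree `2e + 1` and capacity `c`. When the degree is
`1`, all residual edges are saturated. -/
def finish : ℕ → ℚ → (ℕ → Finset ℕ × (ℕ → ℚ)) → ℕ → ℕ → ℚ
  | 0, c, S => fun v u => (S v).2 u + if u ∈ (S v).1 then c else 0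
  | e + 1, c, S => finish e (c / 2) (phase e c S)

variable {d : ℕ} {N : ℕ → Finset ℕ} {c : ℚ} {S : ℕ → Finset ℕ × (ℕ → ℚ)}

theorem IsResidual.isPartial_greedyMatching (h : IsResidual d N c S) {E : ℕ → Finset ℕ}
    (hE : ∀ v, E v ⊆ (S v).1) (k : ℕ) : IsPartial E (greedyMatching (fun v => (S v).1) E k) :=
  DyadicMatching.isPartial_greedyMatching (fun w _ hb => ⟨hE w hb, h.symm _ _ (hE w hb)⟩) k

theorem IsResidual.greedyMatching_maximal (h : IsResidual d N c S) {E : ℕ → Finset ℕ}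
    (hE : ∀ v, E v ⊆ (S v).1) {k w b : ℕ} (hk : (E w).card ≤ k) (hb : b ∈ E w) :
    (greedyMatching (fun v => (S v).1) E k w).1 ≠ ⊤ ∨
      (greedyMatching (fun v => (S v).1) E k b).2 ≠ ⊤ :=
  DyadicMatching.greedyMatching_maximal
    (fun w _ hb => ⟨hE w hb, h.symm _ _ (hE w hb)⟩) hk hb

theorem IsResidual.bichromaticStage (h : IsResidual d N c S) (hc : ∃ m : ℕ, c = m / 2 ^ d)
    (k : ℕ) (q : ℕ → Bool) : IsResidual d N c (bichromaticStage k c q S) := by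
  have hE : ∀ v, ((S v).1.filter fun u => q v = true ∧ q u = false) ⊆ (S v).1 :=
    fun v => Finset.filter_subset _ _
  have hs := h.isPartial_greedyMatching hE k
  unfold DyadicMatching.bichromaticStage
  set s := greedyMatching (fun v => (S v).1)
    (fun v => (S v).1.filter fun u => q v = true ∧ q u = false) k
  have hfst : ∀ v, (s v).1 ≠ ⊤ → q v = true := by
    intro v hv
    obtain ⟨b, hb⟩ := WithTop.ne_top_iff_exists.1 hv
    exact (Finset.mem_filter.1 (hs.mem v b hb.symm)).2.1
  have hsnd : ∀ v, (s v).2 ≠ ⊤ → q v = false := by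
    intro v hv
    obtain ⟨w, hw⟩ := WithTop.ne_top_iff_exists.1 hv
    exact (Finset.mem_filter.1 (hs.mem_of_snd hw.symm)).2.2
  have hone : ∀ v, s v ≠ (⊤, ⊤) → timesMatched (s v) = 1 := by
    intro v hv
    have hq : (s v).1 = ⊤ ∨ (s v).2 = ⊤ := by
      by_contra! hne
      have h1 := hfst v hne.1
      rw [hsnd v hne.2] at h1
      exact Bool.false_ne_true h1
    have hv' : ¬ ((s v).1 = ⊤ ∧ (s v).2 = ⊤) := fun h => hv (Prod.ext h.1 h.2)
    unfold timesMatched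
    rcases hq with hq | hq <;> simp_all
  have hc0 : 0 ≤ c := by
    obtain ⟨m, rfl⟩ := hc
    positivity
  refine h.advance hs hE hc (fun v => ?_) (fun v hv => ?_) fun v u _ hvu => ?_
  · by_cases hv : s v = (⊤, ⊤)
    · simpa [timesMatched, hv] using hc0
    · rw [hone v hv, mul_one]
  · simp [timesMatched, of_decide_eq_true hv]
  · by_cases hv : s v = (⊤, ⊤)
    · by_cases hu : s u = (⊤, ⊤)
      · exact absurd ⟨decide_eq_true hv, decide_eq_true hu⟩ hvu
      · exact Or.inr (by rw [hone u hu, mul_one])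
    · exact Or.inl (by rw [hone v hv, mul_one])

theorem notMem_bichromaticStage (h : IsResidual d N c S) {k : ℕ} (hk : ∀ v, (S v).1.card ≤ k)
    {q : ℕ → Bool} {v u : ℕ} (hq : q v ≠ q u) : u ∉ (bichromaticStage k c q S v).1 := by
  intro hu
  have huS := advance_fst_subset v hu
  simp only [DyadicMatching.bichromaticStage, advance] at hu
  split_ifs at hu with hv
  · have hu := of_decide_eq_true (Finset.mem_filter.1 hu).2
    have hv := of_decide_eq_true hv
    have hE : ∀ v, ((S v).1.filter fun u => q v = true ∧ q u = false) ⊆ (S v).1 :=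
      fun v => Finset.filter_subset _ _
    have hmax := fun w b => h.greedyMatching_maximal hE (k := k) (w := w) (b := b)
      ((Finset.card_le_card (hE w)).trans (hk w))
    cases hqv : q v with
    | true =>
      have hqu : q u = false := by
        cases hqu : q u with
        | false => rfl
        | true => exact absurd (hqv.trans hqu.symm) hq
      have := hmax v u (Finset.mem_filter.2 ⟨huS, hqv, hqu⟩)
      rw [hv, hu] at this
      simp at this
    | false =>
      have hqu : q u = true := by
        cases hqu : q u with
        | true => rfl
        | false => exact absurd (hqv.trans hqu.symm) hq
      have := hmax u v (Finset.mem_filter.2 ⟨h.symm _ _ huS, hqu, hqv⟩)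
      rw [hv, hu] at this
      simp at this
  · exact Finset.notMem_empty u hu

theorem IsResidual.sweep (h : IsResidual d N c S) (hc : ∃ m : ℕ, c = m / 2 ^ d) (k : ℕ)
    (col : ℕ → ℕ → Bool) : ∀ j, IsResidual d N c (sweep k c col S j)
  | 0 => h
  | j + 1 => (h.sweep hc k col j).bichromaticStage hc k _

theorem sweep_subset {k : ℕ} {col : ℕ → ℕ → Bool} (v : ℕ) {i j : ℕ} (hij : i ≤ j) :
    (sweep k c col S j v).1 ⊆ (sweep k c col S i v).1 := by
  induction j, hij using Nat.le_induction with
  | base => exact Finset.Subset.refl _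
  | succ j _ ih => exact (advance_fst_subset v).trans ih

/-- After the bichromatic matchings no node has full odd degree: it would still have all its neighbours, one of
which has a different colour, so that the edge to it has been removed. -/
theorem card_sweep_le (h : IsResidual d N c S) (hN : ∀ v, v ∉ N v) (hc : ∃ m : ℕ, c = m / 2 ^ d)
    {e : ℕ} (hdeg : ∀ v, (S v).1.card ≤ 2 * e + 1) (v : ℕ) :
    (sweep (2 * e + 1) c (colour e fun v => (S v).1) S (2 * e + 3) v).1.card ≤ 2 * e := by
  set col := colour e fun v => (S v).1
  have hsub : (DyadicMatching.sweep (2 * e + 1) c col S (2 * e + 3) v).1 ⊆ (S v).1 :=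
    sweep_subset v (Nat.zero_le _)
  by_contra! hlt
  have hcard := hdeg v
  have heq := Finset.eq_of_subset_of_card_le hsub (by omega)
  obtain ⟨u, hu, j, hj, hne⟩ := exists_colour_ne (H := fun v => (S v).1) h.symm
    (fun v hv => hN v (h.subset v hv)) (e := e) (v := v) (by rw [heq] at hlt; omega)
  refine notMem_bichromaticStage (h.sweep hc (2 * e + 1) col j) (k := 2 * e + 1) (fun w => ?_) hne
    (sweep_subset (i := j + 1) v hj (heq ▸ hu))
  exact (Finset.card_le_card (sweep_subset w (Nat.zero_le j))).trans (hdeg w)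

theorem timesMatched_eq_two {p : WithTop ℕ × WithTop ℕ} (h₁ : p.1 ≠ ⊤) (h₂ : p.2 ≠ ⊤) :
    timesMatched p = 2 := by
  rw [timesMatched, if_neg h₁, if_neg h₂]
  norm_num

theorem IsResidual.halvingStage (h : IsResidual d N c S) (hc : ∃ m : ℕ, c / 2 = m / 2 ^ d)
    {k : ℕ} (hk : ∀ v, (S v).1.card ≤ k) : IsResidual d N (c / 2) (halvingStage k c S) := by
  have hs := h.isPartial_greedyMatching (fun v => Finset.Subset.refl (S v).1) k
  have hmax := fun w b => h.greedyMatching_maximal (fun v => Finset.Subset.refl (S v).1) (k := k)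
    (w := w) (b := b) (hk w)
  unfold DyadicMatching.halvingStage
  set s := greedyMatching (fun v => (S v).1) (fun v => (S v).1) k
  have hc0 : 0 ≤ c := by
    obtain ⟨m, hm⟩ := hc
    have : 0 ≤ c / 2 := by
      rw [hm]
      positivity
    linarith
  refine h.advance hs (fun v => Finset.Subset.refl _) hc (fun v => ?_) (fun v hv => ?_)
    fun v u hu hvu => ?_
  · unfold timesMatched
    split_ifs <;> linarith
  · rw [of_decide_eq_true hv]
    ring
  · have h1 := hmax v u hu
    have h2 := hmax u v (h.symm _ _ hu)
    have hvu : ¬ (timesMatched (s v) = 1 ∧ timesMatched (s u) = 1) :=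
      fun h => hvu ⟨decide_eq_true h.1, decide_eq_true h.2⟩
    -- if neither endpoint is matched twice, then both are matched exactly once
    by_cases hv : (s v).1 ≠ ⊤ ∧ (s v).2 ≠ ⊤
    · exact Or.inl (by rw [timesMatched_eq_two hv.1 hv.2]; ring)
    by_cases hu : (s u).1 ≠ ⊤ ∧ (s u).2 ≠ ⊤
    · exact Or.inr (by rw [timesMatched_eq_two hu.1 hu.2]; ring)
    refine absurd ?_ hvu
    unfold timesMatched
    by_cases a1 : (s v).1 = ⊤ <;> by_cases a2 : (s v).2 = ⊤ <;> by_cases a3 : (s u).1 = ⊤ <;>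
      by_cases a4 : (s u).2 = ⊤ <;> simp_all

/-- The partner of a node that is matched once in the double cover is matched twice, so it leaves the residual
graph. -/
theorem card_halvingStage_le (h : IsResidual d N c S) {k : ℕ} (hk : ∀ v, (S v).1.card ≤ k + 1)
    (v : ℕ) : (halvingStage (k + 1) c S v).1.card ≤ k := by
  have hs := h.isPartial_greedyMatching (fun v => Finset.Subset.refl (S v).1) (k + 1)
  have hmax := fun w b => h.greedyMatching_maximal (fun v => Finset.Subset.refl (S v).1)
    (k := k + 1) (w := w) (b := b) (hk w)
  unfold DyadicMatching.halvingStage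
  set s := greedyMatching (fun v => (S v).1) (fun v => (S v).1) (k + 1)
  unfold advance
  dsimp only
  split_ifs with hv
  · have hv := of_decide_eq_true hv
    suffices hex : ∃ u ∈ (S v).1, timesMatched (s u) = 2 by
      obtain ⟨u, hu, hu2⟩ := hex
      have hlt : ((S v).1.filter fun u => decide (timesMatched (s u) = 1) = true).card <
          (S v).1.card := by
        refine Finset.card_lt_card (Finset.filter_ssubset.2 ⟨u, hu, ?_⟩)
        rw [decide_eq_true_eq, hu2]
        norm_num
      have := hk v
      omega
    by_cases h1 : (s v).1 = ⊤
    · have h2 : (s v).2 ≠ ⊤ := by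
        intro h2
        simp [timesMatched, h1, h2] at hv
      obtain ⟨w, hw⟩ := WithTop.ne_top_iff_exists.1 h2
      have hvw := hs.mem_of_snd hw.symm
      refine ⟨w, h.symm _ _ hvw, timesMatched_eq_two ?_
        ((hmax v w (h.symm _ _ hvw)).resolve_left (not_not.2 h1))⟩
      rw [(hs.iff w v).2 hw.symm]
      exact WithTop.coe_ne_top
    · have h2 : (s v).2 = ⊤ := by
        by_contra h2
        rw [timesMatched_eq_two h1 h2] at hv
        norm_num at hv
      obtain ⟨b, hb⟩ := WithTop.ne_top_iff_exists.1 h1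
      have hvb := hs.mem v b hb.symm
      refine ⟨b, hvb, timesMatched_eq_two
        ((hmax b v (h.symm _ _ hvb)).resolve_right (not_not.2 h2)) ?_⟩
      rw [(hs.iff v b).1 hb.symm]
      exact WithTop.coe_ne_top
  · exact (Finset.card_empty).le.trans (Nat.zero_le k)

theorem IsResidual.phase (h : IsResidual d N c S) (hN : ∀ v, v ∉ N v) {e : ℕ}
    (hc : ∃ m : ℕ, c / 2 = m / 2 ^ d) (hdeg : ∀ v, (S v).1.card ≤ 2 * (e + 1) + 1) :
    IsResidual d N (c / 2) (phase e c S) ∧ ∀ v, (phase e c S v).1.card ≤ 2 * e + 1 := by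
  have hc' : ∃ m : ℕ, c = m / 2 ^ d := by
    obtain ⟨m, hm⟩ := hc
    refine ⟨2 * m, ?_⟩
    push_cast
    linear_combination 2 * hm
  have hsweep := h.sweep hc' (2 * e + 3) (colour (e + 1) fun v => (S v).1) (2 * e + 5)
  have hcard := card_sweep_le h hN hc' hdeg
  exact ⟨hsweep.halvingStage hc hcard, card_halvingStage_le hsweep hcard⟩

/-- The edge values form a maximal fractional matching of `N`. -/
theorem finish_spec (hN : ∀ v, v ∉ N v) (hNs : ∀ v u, u ∈ N v → v ∈ N u) :
    ∀ (e : ℕ) {c : ℚ} {S : ℕ → Finset ℕ × (ℕ → ℚ)}, IsResidual d N c S →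
      (∀ v, (S v).1.card ≤ 2 * e + 1) → (∃ m : ℕ, c = m * 2 ^ e / 2 ^ d) →
      (∀ v u, finish e c S v u = finish e c S u v) ∧
      (∀ v u, ∃ m : ℕ, finish e c S v u = m / 2 ^ d) ∧
      (∀ v, ∑ u ∈ N v, finish e c S v u ≤ 1) ∧
      ∀ v, ∀ u ∈ N v, ∑ z ∈ N v, finish e c S v z = 1 ∨ ∑ z ∈ N u, finish e c S u z = 1
  | e + 1, c, S, h, hdeg, hc => by
    obtain ⟨m, hm⟩ := hc
    have hc2 : c / 2 = (m * 2 ^ e : ℚ) / 2 ^ d := by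
      rw [hm, pow_succ]
      ring
    obtain ⟨hphase, hcard⟩ := h.phase hN ⟨m * 2 ^ e, by rw [hc2]; push_cast; rfl⟩ hdeg
    exact finish_spec hN hNs e hphase hcard ⟨m, hc2⟩
  | 0, c, S, h, hdeg, hc => by
    have hsum : ∀ v, (S v).1.Nonempty → ∑ u ∈ N v, finish 0 c S v u = 1 := by
      intro v hv
      have hcard : (S v).1.card = 1 := le_antisymm (hdeg v) (Finset.card_pos.2 hv)
      simp only [finish]
      rw [Finset.sum_add_distrib, h.load_eq v hv, ← Finset.sum_filter,
        Finset.filter_mem_eq_inter, Finset.inter_eq_right.2 (h.subset v), Finset.sum_const, hcard]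
      simp
    have hsum' : ∀ v, ¬ (S v).1.Nonempty →
        ∑ u ∈ N v, finish 0 c S v u = ∑ u ∈ N v, (S v).2 u := by
      intro v hv
      rw [Finset.not_nonempty_iff_eq_empty] at hv
      simp [finish, hv]
    refine ⟨fun v u => ?_, fun v u => ?_, fun v => ?_, fun v u hu => ?_⟩
    · simp only [finish, h.value_symm v u]
      congr 2
      exact propext ⟨h.symm v u, h.symm u v⟩
    · obtain ⟨m, hm⟩ := h.dyadic v u
      obtain ⟨m₁, hm₁⟩ := hc
      refine ⟨m + if u ∈ (S v).1 then m₁ else 0, ?_⟩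
      simp only [finish, hm, hm₁]
      split_ifs
      · push_cast
        ring
      · simp
    · by_cases hv : (S v).1.Nonempty
      · exact (hsum v hv).le
      · exact (hsum' v hv).trans_le (h.load_le v)
    · by_cases hv : (S v).1.Nonempty
      · exact Or.inl (hsum v hv)
      by_cases hu' : (S u).1.Nonempty
      · exact Or.inr (hsum u hu')
      rw [hsum' v hv, hsum' u hu']
      exact (h.cover v u hu).resolve_left fun huv => hv ⟨u, huv⟩

end Phases

/-! ### The number of rounds -/

section Rounds

variable {r : ℕ} {S : (ℕ → Finset ℕ) → ℕ → Finset ℕ × (ℕ → ℚ)}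

theorem isLocal_bichromaticStage (hS : IsLocal r S) (hSN : ∀ N v, (S N v).1 ⊆ N v)
    {q : (ℕ → Finset ℕ) → ℕ → Bool} (hq : IsLocal r q) (k : ℕ) (c : ℚ) :
    IsLocal (r + (3 * k + 2)) fun N => bichromaticStage k c (q N) (S N) := by
  have hU : IsLocal r fun N v => (S N v).1 := hS.comp fun _ p => p.1
  have hE : IsLocal (r + 1) fun N v =>
      (S N v).1.filter fun u => q N v = true ∧ q N u = false := by
    refine (hU.prodMk hq).exchange fun N N' v hv hu => ?_
    simp only [Prod.mk.injEq] at hv hu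
    rw [← hv.1, ← hv.2]
    refine Finset.filter_congr fun u h => ?_
    rw [(hu u (hSN N v h)).2]
  have hs := isLocal_greedyMatching (hU.mono r.le_succ) hE hSN
    (fun N v => Finset.filter_subset _ _) k
  exact (isLocal_advance (hS.mono (by omega)) hs hSN _ c).mono (by omega)

theorem isLocal_sweep (hS : IsLocal r S) (hSN : ∀ N v, (S N v).1 ⊆ N v)
    {col : (ℕ → Finset ℕ) → ℕ → ℕ → Bool} (hcol : IsLocal r col) (k : ℕ) (c : ℚ) :
    ∀ j, IsLocal (r + j * (3 * k + 2)) fun N => sweep k c (col N) (S N) j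
  | 0 => hS.mono (Nat.le_add_right _ _)
  | j + 1 => by
    refine (isLocal_bichromaticStage (isLocal_sweep hS hSN hcol k c j)
      (fun N v => (sweep_subset v (Nat.zero_le j)).trans (hSN N v))
      ((hcol.comp fun _ f => f j).mono (Nat.le_add_right _ _)) k c).mono ?_
    exact le_of_eq (by ring)

theorem isLocal_phase (hS : IsLocal r S) (hSN : ∀ N v, (S N v).1 ⊆ N v) (e : ℕ) (c : ℚ) :
    IsLocal (r + (12 * e ^ 2 + 58 * e + 64)) fun N => phase e c (S N) := by
  have hcol := isLocal_colour (hS.comp fun _ p => p.1) hSN (e + 1)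
  have hsweep := isLocal_sweep (hS.mono (Nat.le_add_right r 2)) hSN hcol (2 * e + 3) c (2 * e + 5)
  have hsub : ∀ N v, (sweep (2 * e + 3) c (colour (e + 1) fun v => (S N v).1) (S N)
      (2 * e + 5) v).1 ⊆ N v := fun N v => (sweep_subset v (Nat.zero_le _)).trans (hSN N v)
  have hU := hsweep.comp fun _ p => p.1
  have hs := isLocal_greedyMatching hU hU hsub (fun N v => Finset.Subset.refl _) (2 * e + 2)
  refine (isLocal_advance (hsweep.mono (Nat.le_add_right _ _)) hs hsub
    (fun p => timesMatched p = 1) (c / 2)).mono ?_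
  exact le_of_eq (by ring)

theorem phase_subset (hSN : ∀ N v, (S N v).1 ⊆ N v) (e : ℕ) (c : ℚ) (N : ℕ → Finset ℕ) (v : ℕ) :
    (phase e c (S N) v).1 ⊆ N v :=
  (advance_fst_subset v).trans ((sweep_subset v (Nat.zero_le _)).trans (hSN N v))

theorem isLocal_finish : ∀ (e : ℕ) {r : ℕ} {S : (ℕ → Finset ℕ) → ℕ → Finset ℕ × (ℕ → ℚ)} (c : ℚ),
    IsLocal r S → (∀ N v, (S N v).1 ⊆ N v) →
      IsLocal (r + (5 * (2 * e + 1) ^ 3 - 5)) fun N => finish e c (S N)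
  | 0, _, _, c, hS, _ => hS.comp fun _ p u => p.2 u + if u ∈ p.1 then c else 0
  | e + 1, r, S, c, hS, hSN => by
    refine (isLocal_finish e (c / 2) (isLocal_phase hS hSN e c) (phase_subset hSN e c)).mono ?_
    have h1 : 5 ≤ 5 * (2 * e + 1) ^ 3 := by
      have := Nat.one_le_pow 3 (2 * e + 1) (by omega)
      omega
    have h2 : 5 * (2 * (e + 1) + 1) ^ 3 = 5 * (2 * e + 1) ^ 3 + (120 * e ^ 2 + 240 * e + 130) := by
      ring
    rw [h2]
    omega

end Rounds

/-! ### From neighbourhood functions back to graphs -/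

section Graph

variable {V : Type*} [DecidableEq V] {G : SimpleGraph V} [Fintype G.edgeSet]

theorem nodeSum_eq_sum_neighborFinset (x : G.edgeSet → ℚ) (f : V → V → ℚ)
    (hx : ∀ v u (h : G.Adj v u), x ⟨s(v, u), h⟩ = f v u) (v : V) [Fintype (G.neighborSet v)] :
    nodeSum G x v = ∑ u ∈ G.neighborFinset v, f v u := by
  symm
  refine Finset.sum_bij (fun u hu => ⟨s(v, u), (G.mem_neighborFinset v u).1 hu⟩) ?_ ?_ ?_ ?_
  · intro u hu
    simp
  · intro u hu u' hu' h
    exact Sym2.congr_right.1 (congrArg Subtype.val h)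
  · rintro ⟨e, he⟩ hv
    have hv : v ∈ e := (Finset.mem_filter.1 hv).2
    obtain ⟨u, rfl⟩ := Sym2.mem_iff_exists.1 hv
    exact ⟨u, (G.mem_neighborFinset v u).2 he, rfl⟩
  · intro u hu
    exact (hx v u _).symm

theorem le_nodeSum {x : G.edgeSet → ℚ} (hx : ∀ e, 0 ≤ x e) {v : V} {e : G.edgeSet}
    (hv : v ∈ (e : Sym2 V)) : x e ≤ nodeSum G x v :=
  Finset.single_le_sum (f := x) (fun e _ => hx e) (Finset.mem_filter.2 ⟨Finset.mem_univ e, hv⟩)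

end Graph

end DyadicMatching

theorem theorem1 (d : ℕ) :
    ∃ A : LocalAlgorithm ℚ,
      ∀ (V : Type u) [Fintype V] [DecidableEq V] (G : SimpleGraph V) [DecidableRel G.Adj],
        G.maxDegree ≤ 2 * d + 1 →
        ∀ (P : PortNumbering G) (ident : V → ℕ), Function.Injective ident →
          ∃ x : G.edgeSet → ℚ,
            A.ComputesWithin G P ident (5 * (2 * d + 1) ^ 3) x ∧
            IsMaximalFractionalMatching G x ∧
            ∀ e, x e ∈ dyadicFractions d := by
  open DyadicMatching in
  let F : (ℕ → Finset ℕ) → ℕ → ℕ → ℚ := fun N => finish d 1 fun v => (N v, 0)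
  have hF : IsLocal (5 * (2 * d + 1) ^ 3) F := by
    have h1 : 1 ≤ (2 * d + 1) ^ 3 := Nat.one_le_pow _ _ (by omega)
    have h0 : IsLocal 1 fun (N : ℕ → Finset ℕ) v => (N v, (0 : ℕ → ℚ)) :=
      fun N N' v h => Prod.ext h.1 rfl
    exact (isLocal_finish d 1 h0 fun N v => Finset.Subset.refl _).mono (by omega)
  refine ⟨gather (5 * (2 * d + 1) ^ 3) F, fun V _ _ G _ hG P ident hid => ?_⟩
  let N := identGraph G ident
  have hmem : ∀ {v u : V}, G.Adj v u → ident u ∈ N (ident v) :=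
    fun h => mem_identGraph.2 ⟨_, _, rfl, rfl, h⟩
  have hNs : ∀ n m, m ∈ N n → n ∈ N m := by
    intro n m h
    obtain ⟨v, u, hv, hu, h⟩ := mem_identGraph.1 h
    exact mem_identGraph.2 ⟨u, v, hu, hv, h.symm⟩
  have hN : ∀ n, n ∉ N n := by
    intro n h
    obtain ⟨v, u, hv, hu, h⟩ := mem_identGraph.1 h
    exact h.ne (hid (hv.trans hu.symm))
  have hdeg : ∀ n, (N n).card ≤ 2 * d + 1 := by
    intro n
    rcases (N n).eq_empty_or_nonempty with h | ⟨m, hm⟩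
    · simp [h]
    · obtain ⟨v, u, rfl, -, -⟩ := mem_identGraph.1 hm
      rw [show N (ident v) = _ from identGraph_ident hid v, Finset.card_image_of_injective _ hid]
      exact (G.degree_le_maxDegree v).trans hG
  have hres : IsResidual d N 1 fun n => (N n, 0) :=
    { subset := fun _ => Finset.Subset.refl _
      symm := hNs
      value_symm := fun _ _ => rfl
      dyadic := fun _ _ => ⟨0, by simp⟩
      load_le := fun _ => by simp
      load_eq := fun _ _ => by simp
      cover := fun _ _ h => Or.inl h }
  obtain ⟨hsymm, hdy, hload, hcover⟩ :=
    finish_spec hN hNs d hres hdeg ⟨1, by rw [Nat.cast_one, one_mul, div_self (by positivity)]⟩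
  let x : G.edgeSet → ℚ := fun e =>
    Sym2.lift ⟨fun v u => F N (ident v) (ident u), fun v u => hsymm _ _⟩ (e : Sym2 V)
  have hx : ∀ v u (h : G.Adj v u), x ⟨s(v, u), h⟩ = F N (ident v) (ident u) := fun _ _ _ => rfl
  have hsum : ∀ v, nodeSum G x v = ∑ m ∈ N (ident v), F N (ident v) m := by
    intro v
    rw [nodeSum_eq_sum_neighborFinset x _ hx,
      show N (ident v) = _ from identGraph_ident hid v, Finset.sum_image hid.injOn]
  have hxdy : ∀ e, ∃ m : ℕ, x e = m / 2 ^ d := by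
    rintro ⟨e, he⟩
    induction e using Sym2.ind with
    | _ v u => exact hdy _ _
  have hx0 : ∀ e, 0 ≤ x e := fun e => by
    obtain ⟨m, hm⟩ := hxdy e
    rw [hm]
    positivity
  have hnode : ∀ v, nodeSum G x v ≤ 1 := fun v => (hsum v).trans_le (hload _)
  have hx1 : ∀ e, x e ≤ 1 := by
    rintro ⟨e, he⟩
    induction e using Sym2.ind with
    | _ v u => exact (le_nodeSum hx0 (Sym2.mem_mk_left v u)).trans (hnode v)
  refine ⟨x, gather_computesWithin (by positivity) hF hid P hx,
    ⟨⟨fun e => ⟨hx0 e, hx1 e⟩, hnode⟩, fun u v h => ?_⟩, fun e => ?_⟩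
  · rw [hsum, hsum]
    exact hcover _ _ (hmem h)
  · obtain ⟨m, hm⟩ := hxdy e
    refine ⟨m, ?_, hm⟩
    have h1 := hx1 e
    rw [hm, div_le_one (by positivity)] at h1
    exact_mod_cast h1
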